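/- Let $I=[0,1]$ and let $D\subseteq\mathbb{R}^2$ be a convex Jordan domain, i.e. a convex set homeomorphic to a closed disk. Write $\partial D$ for its topological boundary, and $L$ for the length of a curve (the supremum of the lengths of inscribed polygonal lines). A sensor curve in $D$ is a continuous map $f\colon I\times I\to D$ such that (i) for each $t\in(0,1)$ the curve $f(\cdot,t)$ is rectifiable and injective; (ii) each of $f(I,0)$ and $f(I,1)$ is a single point of $\partial D$; (iii) $f(s,t)\in\partial D$ if and only if $s\in\{0,1\}$ or $t\in\{0,1\}$. Its length is $L(f)=\sup_{t\in I}L(f(\cdot,t))$. It is a sweep of $D$ if for every continuous $\gamma\colon I\to D$ there is $t\in I$ with $\gamma(t)\in f(I,t)$. The sweeping cost $\mathrm{SC}(D)$ is the infimum of $L(f)$ over all sweeps $f$ of $D$, and the width of $D$ is $$w(D)=\min_{\|v\|=1}\ \max_{x\in\mathbb{R}^2}\ L\bigl(D\cap\{x+tv : t\in\mathbb{R}\}\bigr).$$ Then $\mathrm{SC}(D)=w(D)$, and this number is the minimal distance between two parallel supporting lines on opposite sides of $D$. -/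

import Mathlib

open scoped unitInterval ENNReal

noncomputable section

/-- The Euclidean plane. -/
abbrev Plane : Type := EuclideanSpace ℝ (Fin 2)

/-- A Jordan domain: a subset of the plane homeomorphic to the closed unit disk. -/
def IsJordanDomain (D : Set Plane) : Prop :=
  Nonempty (Metric.closedBall (0 : Plane) 1 ≃ₜ D)

/-- The length of a curve `c : [0,1] → ℝ²`: the supremum of the lengths of inscribed polygons. -/
def curveLength (c : I → Plane) : ℝ≥0∞ :=
  eVariationOn c Set.univ

/-- `f s t` is the point with spatial parameter `s` of the sensor curve at time `t`. The boundary of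
`D` is touched exactly by the two end points of the curve, and at the times `0` and `1`. -/
structure IsSensorCurve (D : Set Plane) (f : I → I → Plane) : Prop where
  continuous : Continuous (fun q : I × I => f q.1 q.2)
  mem : ∀ s t, f s t ∈ D
  rectifiable : ∀ t : I, 0 < t → t < 1 → curveLength (fun s => f s t) ≠ ⊤
  injective : ∀ t : I, 0 < t → t < 1 → Function.Injective (fun s => f s t)
  start_point : ∃ p ∈ frontier D, ∀ s, f s 0 = p
  end_point : ∃ p ∈ frontier D, ∀ s, f s 1 = p
  mem_frontier_iff : ∀ s t, f s t ∈ frontier D ↔ (s = 0 ∨ s = 1) ∨ (t = 0 ∨ t = 1)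

/-- A sweep: a sensor curve that catches every continuously moving intruder `γ` in `D`. -/
def IsSweep (D : Set Plane) (f : I → I → Plane) : Prop :=
  IsSensorCurve D f ∧
    ∀ γ : I → Plane, Continuous γ → (∀ t, γ t ∈ D) → ∃ t, γ t ∈ Set.range (fun s => f s t)

/-- The length of a sensor curve: the largest length over all times. -/
def sensorLength (f : I → I → Plane) : ℝ≥0∞ :=
  ⨆ t : I, curveLength (fun s => f s t)

/-- The sweeping cost of `D`: the infimum of the lengths of the sweeps of `D`. -/
def sweepingCost (D : Set Plane) : ℝ≥0∞ :=
  ⨅ (f : I → I → Plane) (_ : IsSweep D f), sensorLength f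

/-- The length of `D ∩ {x + t v | t ∈ ℝ}` for a unit vector `v`; since `t ↦ x + t v` is an isometry,
it is the Lebesgue measure of the set of parameters `t`. -/
def chordLength (D : Set Plane) (v x : Plane) : ℝ≥0∞ :=
  MeasureTheory.volume {t : ℝ | x + t • v ∈ D}

/-- The width of `D`: minimize, over unit direction vectors `v`, the largest length of an
intersection of `D` with a line of direction `v`. -/
def width (D : Set Plane) : ℝ≥0∞ :=
  ⨅ (v : Plane) (_ : ‖v‖ = 1), ⨆ x : Plane, chordLength D v x

/-- The distances between two parallel supporting lines on opposite sides of `D`. With unit normal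
`u`, these are the lines `⟪u, x⟫ = a` and `⟪u, x⟫ = b`, where `a` and `b` are the least and the
greatest value of `⟪u, x⟫` on `D`; their distance is `b - a`. -/
def supportingLineDistances (D : Set Plane) : Set ℝ≥0∞ :=
  {w | ∃ (u : Plane) (a b : ℝ), ‖u‖ = 1 ∧
    IsLeast ((fun x : Plane => inner ℝ u x) '' D) a ∧
    IsGreatest ((fun x : Plane => inner ℝ u x) '' D) b ∧
    w = ENNReal.ofReal (b - a)}

end

open Set Filter Topology

/-! Let `W` be the least extent of `D` over all unit directions. Sweeping cost and width are both
shown to equal `W`. Lower bounds: if `‖d‖ < W`, then `interior D` meets its translate by `d`, since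
a separating line would give an extent at most `‖d‖` (`Convex.exists_translate_mem_interior`). With
`d = r • v` this yields a chord of length at least `r` in every direction `v`. If a sensor curve is
shorter than `W`, take `d = b t - a t` for its end points: there is a segment from `z t` to `z t +
d` inside `interior D`, with `z` continuous. The ray from its midpoint in direction `z t - a t`
leaves `D` at a point other than `a t` and `b t` (`Convex.exists_continuous_frontier_avoiding`). An
intruder there is never caught, because the sensor touches the boundary only at its end points.
Upper bounds: chords parallel to a direction `u` are no longer than the extent along `u`. Sweeping
by them fails only if an extreme chord is a segment instead of a point; almost every small tilt of
`u` avoids this (`exists_isUniqueMinOn_perturbation`, `Convex.exists_isSweep`). -/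

theorem IsJordanDomain.isCompact {D : Set Plane} (hD : IsJordanDomain D) : IsCompact D := by
  obtain ⟨φ⟩ := hD
  have : CompactSpace (Metric.closedBall (0 : Plane) 1) :=
    isCompact_iff_compactSpace.1 (isCompact_closedBall 0 1)
  exact isCompact_iff_compactSpace.2 φ.compactSpace

/-! ### Plane linear algebra; convex Jordan domains have interior points. -/

theorem Plane.inner_eq (x y : Plane) : inner ℝ x y = x 0 * y 0 + x 1 * y 1 := by
  simp [PiLp.inner_apply, Fin.sum_univ_two, mul_comm]

theorem Plane.eq_zero_of_inner_eq_zero {n e x : Plane} (hn : n ≠ 0) (he : e ≠ 0)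
    (hne : inner ℝ n e = 0) (h₁ : inner ℝ n x = 0) (h₂ : inner ℝ e x = 0) : x = 0 := by
  have hn' := inner_self_ne_zero (𝕜 := ℝ).2 hn
  have he' := inner_self_ne_zero (𝕜 := ℝ).2 he
  rw [Plane.inner_eq] at hne h₁ h₂ hn' he'
  have hdet : n 0 * e 1 - n 1 * e 0 ≠ 0 := by
    intro h
    refine mul_ne_zero hn' he' ?_
    -- Lagrange's identity: `|n|²|e|²` is the squared determinant plus the squared inner product.
    linear_combination (n 0 * e 1 - n 1 * e 0) * h + (n 0 * e 0 + n 1 * e 1) * hne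
  ext i
  fin_cases i
  · refine (mul_eq_zero.1 ?_).resolve_left hdet
    simp only [Fin.zero_eta]
    linear_combination e 1 * h₁ - n 1 * h₂
  · refine (mul_eq_zero.1 ?_).resolve_left hdet
    simp only [Fin.mk_one]
    linear_combination n 0 * h₂ - e 0 * h₁

/-- Rotation by a right angle. -/
def Plane.rot (u : Plane) : Plane := !₂[-u 1, u 0]

theorem Plane.inner_rot_self (u : Plane) : inner ℝ (Plane.rot u) u = 0 := by
  simp [Plane.inner_eq, Plane.rot]; ring

theorem Plane.inner_rot_rot (u : Plane) :
    inner ℝ (Plane.rot u) (Plane.rot u) = inner ℝ u u := by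
  rw [Plane.inner_eq, Plane.inner_eq]
  simp [Plane.rot]; ring

theorem Plane.rot_ne_zero {u : Plane} (hu : u ≠ 0) : Plane.rot u ≠ 0 := by
  rw [← inner_self_ne_zero (𝕜 := ℝ), Plane.inner_rot_rot]
  exact inner_self_ne_zero.2 hu

/-- The disk does not embed into the line. -/
theorem Plane.not_injective_of_continuous_closedBall {φ : Metric.closedBall (0 : Plane) 1 → ℝ} (hφ : Continuous φ) :
    ¬ Function.Injective φ := by
  intro hinj
  have hmem : ∀ x : Metric.sphere (0 : Plane) 1, (x : Plane) ∈ Metric.closedBall (0 : Plane) 1 :=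
    fun x => Metric.sphere_subset_closedBall x.2
  -- Borsuk–Ulam for the circle: an odd continuous function on a connected set has a zero.
  let ψ : Metric.sphere (0 : Plane) 1 → ℝ := fun x => φ ⟨x, hmem x⟩ - φ ⟨(-x : _), hmem (-x)⟩
  have hψ : Continuous ψ := by
    refine (hφ.comp (by fun_prop)).sub (hφ.comp ?_)
    exact Continuous.subtype_mk (continuous_subtype_val.comp continuous_neg) _
  have : PreconnectedSpace (Metric.sphere (0 : Plane) 1) := by
    refine Subtype.preconnectedSpace (isPreconnected_sphere ?_ 0 1)
    rw [← Module.finrank_eq_rank]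
    simp
  have hodd : ∀ x, ψ (-x) = -ψ x := by
    intro x; simp [ψ]
  let x₀ : Metric.sphere (0 : Plane) 1 := ⟨EuclideanSpace.single 0 1, by simp⟩
  obtain ⟨x, hx⟩ : ∃ x, ψ x = 0 := by
    rcases le_total (ψ x₀) 0 with h | h
    · exact mem_range_of_exists_le_of_exists_ge hψ ⟨x₀, h⟩ ⟨-x₀, by rw [hodd]; linarith⟩
    · exact mem_range_of_exists_le_of_exists_ge hψ ⟨-x₀, by rw [hodd]; linarith⟩ ⟨x₀, h⟩
  have h := congrArg Subtype.val (hinj (sub_eq_zero.1 hx))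
  have h0 : (x : Plane) = 0 := by
    have h' : (x : Plane) = -x := h
    ext i
    have := congrArg (fun y : Plane => y i) h'
    simp only [PiLp.neg_apply] at this
    simp only [PiLp.zero_apply]
    linarith
  have h1 := x.2
  rw [mem_sphere_zero_iff_norm, h0] at h1
  simp at h1

theorem IsJordanDomain.nonempty {D : Set Plane} (hD : IsJordanDomain D) : D.Nonempty := by
  obtain ⟨φ⟩ := hD
  exact ⟨_, (φ ⟨0, by simp⟩).2⟩

/-- Otherwise `D` lies in a line orthogonal to some `u ≠ 0`, and the coordinate along `Plane.rot u`
would embed the disk into `ℝ`. -/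
theorem IsJordanDomain.interior_nonempty {D : Set Plane} (hD : IsJordanDomain D)
    (hconv : Convex ℝ D) : (interior D).Nonempty := by
  rw [hconv.interior_nonempty_iff_affineSpan_eq_top]
  by_contra h
  have hdir : (affineSpan ℝ D).direction ≠ ⊤ := by
    rwa [Ne, AffineSubspace.direction_eq_top_iff_of_nonempty
      ((affineSpan_nonempty ℝ).2 hD.nonempty)]
  rw [Ne, ← Submodule.orthogonal_eq_bot_iff] at hdir
  obtain ⟨u, hu, hu0⟩ := Submodule.exists_mem_ne_zero_of_ne_bot hdir
  have hconst : ∀ x ∈ D, ∀ y ∈ D, inner ℝ u (x - y) = 0 := by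
    intro x hx y hy
    refine Submodule.inner_left_of_mem_orthogonal (K := (affineSpan ℝ D).direction) ?_ hu
    rw [direction_affineSpan]
    exact vsub_mem_vectorSpan ℝ hx hy
  obtain ⟨φ⟩ := hD
  refine Plane.not_injective_of_continuous_closedBall (φ := fun p => inner ℝ (Plane.rot u) (φ p : Plane)) (by fun_prop) ?_
  intro p q hpq
  refine φ.injective (Subtype.ext (sub_eq_zero.1 ?_))
  refine Plane.eq_zero_of_inner_eq_zero hu0 (Plane.rot_ne_zero hu0) ?_
    (hconst _ (φ p).2 _ (φ q).2) ?_
  · rw [real_inner_comm, Plane.inner_rot_self]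
  · rw [inner_sub_right, sub_eq_zero]; exact hpq

/-! ### Extents of a compact set and translates of a convex body. -/

section Inner

variable {E : Type*} [NormedAddCommGroup E] [InnerProductSpace ℝ E]

theorem IsCompact.exists_isLeast_inner {D : Set E} (hD : IsCompact D) (hne : D.Nonempty) (u : E) :
    ∃ p ∈ D, IsLeast ((fun x : E => inner ℝ u x) '' D) (inner ℝ u p) := by
  obtain ⟨p, hp, h⟩ := hD.exists_isMinOn hne (f := fun x : E => inner ℝ u x) (by fun_prop)
  exact ⟨p, hp, mem_image_of_mem _ hp, by rintro _ ⟨y, hy, rfl⟩; exact h hy⟩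

theorem IsCompact.exists_isGreatest_inner {D : Set E} (hD : IsCompact D) (hne : D.Nonempty)
    (u : E) : ∃ p ∈ D, IsGreatest ((fun x : E => inner ℝ u x) '' D) (inner ℝ u p) := by
  obtain ⟨p, hp, h⟩ := hD.exists_isMaxOn hne (f := fun x : E => inner ℝ u x) (by fun_prop)
  exact ⟨p, hp, mem_image_of_mem _ hp, by rintro _ ⟨y, hy, rfl⟩; exact h hy⟩

/-- Among all unit vectors there is one in whose direction a compact set has the least extent. -/
theorem IsCompact.exists_isLeast_extent [FiniteDimensional ℝ E] [Nontrivial E] {D : Set E}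
    (hD : IsCompact D) (hne : D.Nonempty) :
    ∃ (u : E) (a b : ℝ), ‖u‖ = 1 ∧ IsLeast ((fun x : E => inner ℝ u x) '' D) a ∧
      IsGreatest ((fun x : E => inner ℝ u x) '' D) b ∧
      ∀ (u' : E) (a' b' : ℝ), ‖u'‖ = 1 → IsLeast ((fun x : E => inner ℝ u' x) '' D) a' →
        IsGreatest ((fun x : E => inner ℝ u' x) '' D) b' → b - a ≤ b' - a' := by
  have hcont : Continuous fun u : E => sSup ((fun x : E => (inner ℝ u x : ℝ)) '' D)
      - sInf ((fun x : E => (inner ℝ u x : ℝ)) '' D) :=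
    (hD.continuous_sSup (f := fun u x : E => (inner ℝ u x : ℝ)) (by fun_prop)).sub
      (hD.continuous_sInf (f := fun u x : E => (inner ℝ u x : ℝ)) (by fun_prop))
  obtain ⟨u, hu, hmin⟩ := (isCompact_sphere (0 : E) 1).exists_isMinOn
    (NormedSpace.sphere_nonempty.2 zero_le_one) hcont.continuousOn
  obtain ⟨p, -, hp⟩ := hD.exists_isLeast_inner hne u
  obtain ⟨q, -, hq⟩ := hD.exists_isGreatest_inner hne u
  refine ⟨u, _, _, by simpa using hu, hp, hq, fun u' a' b' hu' ha' hb' => ?_⟩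
  have h := hmin (show u' ∈ Metric.sphere (0 : E) 1 by simpa using hu')
  simp only [mem_ofPred_eq] at h
  rwa [hp.csInf_eq, hq.csSup_eq, ha'.csInf_eq, hb'.csSup_eq] at h

/-- A convex body meets the interior of each of its translates by less than its minimal extent. -/
theorem Convex.exists_translate_mem_interior [CompleteSpace E] {D : Set E} (hconv : Convex ℝ D)
    (hD : IsCompact D) (hint : (interior D).Nonempty) {W : ℝ}
    (hW : ∀ (u : E) (a b : ℝ), ‖u‖ = 1 → IsLeast ((fun x : E => inner ℝ u x) '' D) a →
        IsGreatest ((fun x : E => inner ℝ u x) '' D) b → W ≤ b - a)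
    {d : E} (hd : ‖d‖ < W) : ∃ z ∈ interior D, z + d ∈ interior D := by
  by_contra! hcon
  have hne : D.Nonempty := hint.mono interior_subset
  have hdisj : Disjoint (interior D) ((fun z => z + d) ⁻¹' interior D) :=
    Set.disjoint_left.2 fun z hz hz' => hcon z hz hz'
  -- The preimage is `interior D - d`, so on `D` the separating functional lies between `s + ⟪v, d⟫`
  -- and `s`.
  obtain ⟨f, s, hs, ht⟩ := geometric_hahn_banach_open hconv.interior isOpen_interior
    (hconv.interior.translate_preimage_left d) hdisj
  obtain ⟨o, ho⟩ := hint
  have hf : f ≠ 0 := by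
    rintro rfl
    have h1 := hs o ho
    have h2 := ht (o - d) (by simpa using ho)
    simp at h1 h2
    linarith
  obtain ⟨v, rfl⟩ := (InnerProductSpace.toDual ℝ E).surjective f
  simp only [InnerProductSpace.toDual_apply_apply] at hs ht
  have hv : v ≠ 0 := by rintro rfl; simp at hf
  have hv' : 0 < ‖v‖ := norm_pos_iff.2 hv
  set u : E := ‖v‖⁻¹ • v with hu
  have hu1 : ‖u‖ = 1 := by rw [hu, norm_smul, norm_inv, norm_norm, inv_mul_cancel₀ hv'.ne']
  have hcl : D ⊆ closure (interior D) := by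
    rw [hconv.closure_interior_eq_closure_of_nonempty_interior ⟨o, ho⟩]
    exact subset_closure
  have h1 : ∀ x ∈ D, inner ℝ v x ≤ s := fun x hx =>
    closure_minimal (s := interior D) (t := {x | inner ℝ v x ≤ s}) (fun y hy => (hs y hy).le)
      (isClosed_le (by fun_prop) continuous_const) (hcl hx)
  have h2 : ∀ x ∈ D, s ≤ inner ℝ v (x - d) := fun x hx =>
    closure_minimal (s := interior D) (t := {x | s ≤ inner ℝ v (x - d)})
      (fun y hy => ht _ (by simpa using hy))
      (isClosed_le continuous_const (by fun_prop)) (hcl hx)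
  obtain ⟨p, hpD, hp⟩ := hD.exists_isLeast_inner hne u
  obtain ⟨q, hqD, hq⟩ := hD.exists_isGreatest_inner hne u
  have h3 := hW u _ _ hu1 hp hq
  have h4 : inner ℝ v q - inner ℝ v p ≤ ‖v‖ * ‖d‖ := by
    have := h1 q hqD
    have := h2 p hpD
    rw [inner_sub_right] at this
    have h5 := (abs_le.1 (abs_real_inner_le_norm v d)).1
    linarith
  have h5 : inner ℝ u q - inner ℝ u p ≤ ‖d‖ := by
    rw [hu, real_inner_smul_left, real_inner_smul_left, ← mul_sub, inv_mul_le_iff₀ hv']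
    exact h4
  linarith

end Inner

/-! ### Escaping along the boundary: the lower bound for the sweeping cost. -/

theorem continuous_of_isClosed_graph_of_compactSpace {X K : Type*} [TopologicalSpace X]
    [TopologicalSpace K] [CompactSpace K] {f : X → K} (h : IsClosed {p : X × K | f p.1 = p.2}) :
    Continuous f := by
  refine continuous_iff_isClosed.2 fun C hC => ?_
  have : f ⁻¹' C = Prod.fst '' ({p : X × K | f p.1 = p.2} ∩ Prod.snd ⁻¹' C) := by
    ext x
    constructor
    · intro hx; exact ⟨(x, f x), ⟨rfl, hx⟩, rfl⟩
    · rintro ⟨⟨y, k⟩, ⟨h1, h2⟩, rfl⟩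
      have : f y = k := h1
      simpa [this] using h2
  rw [this]
  exact isClosedMap_fst_of_compactSpace _ (h.inter (hC.preimage continuous_snd))

/-- The point where a ray from an interior point leaves a convex body depends continuously on the
ray. -/
theorem Convex.exists_continuous_exit {X E : Type*} [TopologicalSpace X] [CompactSpace X]
    [NormedAddCommGroup E] [NormedSpace ℝ E] {D : Set E} (hconv : Convex ℝ D)
    (hD : IsCompact D) {w v : X → E} (hw : Continuous w) (hv : Continuous v)
    (hwD : ∀ x, w x ∈ interior D) (hv0 : ∀ x, v x ≠ 0) :
    ∃ r : X → ℝ, Continuous r ∧ ∀ x, 0 ≤ r x ∧ w x + r x • v x ∈ frontier D := by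
  have hfr : frontier D = D \ interior D := hD.isClosed.frontier_eq
  obtain ⟨R, hR⟩ := hD.isBounded.subset_closedBall 0
  have hR' : ∀ x ∈ D, ‖x‖ ≤ R := fun x hx => by simpa using hR hx
  obtain ⟨m, hm, hmv⟩ : ∃ m : ℝ, 0 < m ∧ ∀ x, m ≤ ‖v x‖ := by
    rcases isEmpty_or_nonempty X with hX | hX
    · exact ⟨1, one_pos, fun x => hX.elim x⟩
    · obtain ⟨x₀, -, h⟩ := isCompact_univ.exists_isMinOn univ_nonempty
        (f := fun x => ‖v x‖) (by fun_prop)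
      exact ⟨‖v x₀‖, norm_pos_iff.2 (hv0 x₀), fun x => h (mem_univ x)⟩
  -- Confining the exit parameter to a compact interval lets the closed graph criterion apply.
  have hbound : ∀ x (r : ℝ), 0 ≤ r → w x + r • v x ∈ D → r ∈ Icc 0 (2 * R / m) := by
    intro x r hr h
    refine ⟨hr, (le_div_iff₀ hm).2 ?_⟩
    have h1 := hR' _ h
    have h2 := hR' _ (interior_subset (hwD x))
    have h3 : ‖r • v x‖ ≤ ‖w x + r • v x‖ + ‖w x‖ := by
      simpa using norm_sub_le (w x + r • v x) (w x)
    rw [norm_smul, Real.norm_of_nonneg hr] at h3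
    nlinarith [mul_le_mul_of_nonneg_left (hmv x) hr]
  have hex : ∀ x, ∃ r : Icc 0 (2 * R / m), w x + (r : ℝ) • v x ∈ frontier D := by
    intro x
    have hcl : IsClosed {r : ℝ | 0 ≤ r ∧ w x + r • v x ∈ D} :=
      (isClosed_le continuous_const continuous_id).inter
        (hD.isClosed.preimage (f := fun r : ℝ => w x + r • v x) (by fun_prop))
    have hcpt : IsCompact {r : ℝ | 0 ≤ r ∧ w x + r • v x ∈ D} :=
      isCompact_Icc.of_isClosed_subset hcl fun r hr => hbound x r hr.1 hr.2
    obtain ⟨r, ⟨hr, hrD⟩, hmax⟩ := hcpt.exists_isGreatest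
      ⟨0, le_rfl, by simpa using interior_subset (hwD x)⟩
    refine ⟨⟨r, hbound x r hr hrD⟩, ?_⟩
    rw [hfr]
    refine ⟨hrD, fun hi => ?_⟩
    have hnhds : ∀ᶠ r' in 𝓝 r, w x + r' • v x ∈ interior D :=
      (show Continuous fun r' : ℝ => w x + r' • v x by fun_prop).continuousAt.eventually
        (isOpen_interior.mem_nhds hi)
    obtain ⟨r', hr', hlt⟩ := ((hnhds.filter_mono nhdsWithin_le_nhds).and
      (self_mem_nhdsWithin (s := Ioi r))).exists
    exact absurd (hmax ⟨hr.trans (le_of_lt hlt), interior_subset hr'⟩) (not_le.2 hlt)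
  -- Hence a ray meets the frontier only once, and the graph of `r` is the preimage of the frontier.
  have huniq : ∀ x (r r' : ℝ), 0 ≤ r → r < r' → w x + r' • v x ∈ D →
      w x + r • v x ∈ interior D := by
    intro x r r' hr hrr' h
    have hr' : 0 < r' := hr.trans_lt hrr'
    have := hconv.combo_interior_self_mem_interior (hwD x) h (a := 1 - r / r') (b := r / r')
      (by rw [sub_pos, div_lt_one hr']; exact hrr') (by positivity) (by ring)
    convert this using 1
    rw [smul_add, smul_smul, div_mul_cancel₀ _ hr'.ne', sub_smul, one_smul]
    abel
  choose r hr using hex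
  refine ⟨fun x => r x, ?_, fun x => ⟨(r x).2.1, hr x⟩⟩
  refine continuous_subtype_val.comp (continuous_of_isClosed_graph_of_compactSpace ?_)
  have : {p : X × Icc 0 (2 * R / m) | r p.1 = p.2} =
      (fun p : X × Icc 0 (2 * R / m) => w p.1 + (p.2 : ℝ) • v p.1) ⁻¹' frontier D := by
    ext ⟨x, s⟩
    simp only [mem_ofPred_eq, mem_preimage]
    constructor
    · rintro rfl; exact hr x
    · intro hs
      have h1 := hr x
      rw [hfr] at h1 hs
      refine Subtype.ext (le_antisymm (not_lt.1 fun h => ?_) (not_lt.1 fun h => ?_))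
      · exact hs.2 (huniq x _ _ s.2.1 h h1.1)
      · exact h1.2 (huniq x _ _ (r x).2.1 h hs.1)
  rw [this]
  exact isClosed_frontier.preimage (by fun_prop)

/-- Two boundary points moving in a convex body and staying closer than its minimal extent can be
avoided by a point that moves in the boundary. -/
theorem Convex.exists_continuous_frontier_avoiding {E : Type*} [NormedAddCommGroup E]
    [InnerProductSpace ℝ E] [CompleteSpace E] {D : Set E}
    (hconv : Convex ℝ D) (hD : IsCompact D) (hint : (interior D).Nonempty) {W : ℝ}
    (hW : ∀ (u : E) (a b : ℝ), ‖u‖ = 1 → IsLeast ((fun x : E => inner ℝ u x) '' D) a →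
        IsGreatest ((fun x : E => inner ℝ u x) '' D) b → W ≤ b - a)
    {a b : I → E} (ha : Continuous a) (hb : Continuous b) (haD : ∀ t, a t ∈ frontier D)
    (hbD : ∀ t, b t ∈ frontier D) (hab : ∀ t, ‖b t - a t‖ < W) :
    ∃ γ : I → E, Continuous γ ∧ ∀ t, γ t ∈ frontier D ∧ γ t ≠ a t ∧ γ t ≠ b t := by
  have hfr : frontier D = D \ interior D := hD.isClosed.frontier_eq
  rw [hfr] at haD hbD
  -- The admissible sets are convex, and by openness an admissible `c` stays admissible for nearby
  -- times.
  obtain ⟨z, hz⟩ := exists_continuous_forall_mem_convex_of_local_const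
    (t := fun t : I => interior D ∩ (fun z => z + (b t - a t)) ⁻¹' interior D)
    (fun t => hconv.interior.inter (hconv.interior.translate_preimage_left _))
    (fun t => by
      obtain ⟨c, hc, hc'⟩ := hconv.exists_translate_mem_interior hD hint hW (hab t)
      have : ContinuousAt (fun t => c + (b t - a t)) t := by fun_prop
      exact ⟨c, (this.eventually (isOpen_interior.mem_nhds hc')).mono fun y hy => ⟨hc, hy⟩⟩)
  have key : ∀ t (r : ℝ), 1 ≤ r →
      z t + (1 / (2 * r)) • (b t - a t) ∈ interior D ∧
      z t + (1 - 1 / (2 * r)) • (b t - a t) ∈ interior D := by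
    intro t r hr
    have h1 : 0 ≤ 1 / (2 * r) := by positivity
    have h2 : 1 / (2 * r) ≤ 1 := by rw [div_le_one (by positivity)]; linarith
    obtain ⟨hz1, hz2⟩ := hz t
    constructor
    · convert hconv.interior hz1 hz2 (sub_nonneg.2 h2) h1 (by ring) using 1
      module
    · convert hconv.interior hz1 hz2 h1 (sub_nonneg.2 h2) (by ring) using 1
      module
  obtain ⟨r, hr, hrD⟩ := hconv.exists_continuous_exit hD
    (w := fun t => z t + (1 / 2 : ℝ) • (b t - a t)) (v := fun t => z t - a t)
    (by fun_prop) (by fun_prop)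
    (fun t => by simpa using (key t 1 le_rfl).1)
    (fun t h => (haD t).2 (by rw [← sub_eq_zero.1 h]; exact (hz t).1))
  refine ⟨fun t => z t + (1 / 2 : ℝ) • (b t - a t) + r t • (z t - a t), by fun_prop,
    fun t => ⟨(hrD t).2, fun h => ?_, fun h => ?_⟩⟩
  all_goals
    have hr0 := (hrD t).1
    have hr1 : 1 + r t ≠ 0 := by positivity
  · refine (haD t).2 ?_
    have := (key t (1 + r t) (by linarith)).1
    -- Solving `γ t = a t` for `a t` puts it on the segment from `z t` to `z t + (b t - a t)`, hence
    -- in the interior.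
    have e : a t = z t + (1 / (2 * (1 + r t))) • (b t - a t) := by
      have h' : (1 + r t) • (z t + (1 / (2 * (1 + r t))) • (b t - a t) - a t) = 0 := by
        rw [smul_sub, smul_add, smul_smul,
          show (1 + r t) * (1 / (2 * (1 + r t))) = 1 / 2 by field_simp, ← sub_eq_zero.2 h]
        module
      exact (sub_eq_zero.1 ((smul_eq_zero.1 h').resolve_left hr1)).symm
    rwa [← e] at this
  · refine (hbD t).2 ?_
    have := (key t (1 + r t) (by linarith)).2
    have e : b t = z t + (1 - 1 / (2 * (1 + r t))) • (b t - a t) := by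
      have h' : (1 + r t) • (z t + (1 - 1 / (2 * (1 + r t))) • (b t - a t) - b t) = 0 := by
        rw [smul_sub, smul_add, smul_smul,
          show (1 + r t) * (1 - 1 / (2 * (1 + r t))) = 1 / 2 + r t by field_simp; ring,
          ← sub_eq_zero.2 h]
        module
      exact (sub_eq_zero.1 ((smul_eq_zero.1 h').resolve_left hr1)).symm
    rwa [← e] at this

theorem IsSweep.le_sensorLength {D : Set Plane} (hconv : Convex ℝ D) (hD : IsCompact D)
    (hint : (interior D).Nonempty) {W : ℝ}
    (hW : ∀ (u : Plane) (a b : ℝ), ‖u‖ = 1 → IsLeast ((fun x : Plane => inner ℝ u x) '' D) a →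
        IsGreatest ((fun x : Plane => inner ℝ u x) '' D) b → W ≤ b - a)
    {f : I → I → Plane} (hf : IsSweep D f) : ENNReal.ofReal W ≤ sensorLength f := by
  obtain ⟨hs, hcatch⟩ := hf
  by_contra! hlt
  have hlen : ∀ t, ‖f 1 t - f 0 t‖ < W := by
    intro t
    have h1 : edist (f 1 t) (f 0 t) ≤ curveLength fun s => f s t :=
      eVariationOn.edist_le (fun s => f s t) (mem_univ _) (mem_univ _)
    have h2 := (h1.trans (le_iSup (fun t : I => curveLength fun s => f s t) t)).trans_lt hlt
    rw [edist_dist, dist_eq_norm] at h2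
    exact (ENNReal.ofReal_lt_ofReal_iff'.1 h2).1
  obtain ⟨γ, hγ, h⟩ := hconv.exists_continuous_frontier_avoiding hD hint hW
    (a := fun t => f 0 t) (b := fun t => f 1 t)
    (hs.continuous.comp (by fun_prop : Continuous fun t : I => ((0 : I), t)))
    (hs.continuous.comp (by fun_prop : Continuous fun t : I => ((1 : I), t)))
    (fun t => (hs.mem_frontier_iff 0 t).2 (by simp))
    (fun t => (hs.mem_frontier_iff 1 t).2 (by simp)) hlen
  obtain ⟨t, s, hst⟩ := hcatch γ hγ fun t => hD.isClosed.frontier_subset (h t).1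
  obtain ⟨h1, h2, h3⟩ := h t
  simp only at hst h2 h3
  rw [← hst] at h1 h2 h3
  -- At times `0` and `1` the curve is a single point, so it coincides with its own end point `f 0
  -- t`.
  rcases (hs.mem_frontier_iff s t).1 h1 with (rfl | rfl) | (rfl | rfl)
  · exact h2 rfl
  · exact h3 rfl
  · obtain ⟨p, -, hp⟩ := hs.start_point
    exact h2 (by rw [hp, hp])
  · obtain ⟨p, -, hp⟩ := hs.end_point
    exact h2 (by rw [hp, hp])

/-! ### Directions with unique extreme points. -/

section Inner

variable {E : Type*} [NormedAddCommGroup E] [InnerProductSpace ℝ E]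

/-- For almost every `τ`, the functional `v + τ u` is maximized on a compact set only at points with
the same value of `u`: the derivative of the support function along `τ`. -/
theorem IsCompact.ae_inner_eq_of_isMaxOn {D : Set E} (hD : IsCompact D) (hne : D.Nonempty)
    (v u : E) : ∀ᵐ τ : ℝ, ∃ m : ℝ, ∀ x ∈ D, IsMaxOn (fun y => inner ℝ (v + τ • u) y) D x →
      inner ℝ u x = m := by
  have hmax : ∀ τ : ℝ, ∃ p ∈ D, IsMaxOn (fun y => inner ℝ (v + τ • u) y) D p := fun τ =>
    hD.exists_isMaxOn hne (by fun_prop)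
  choose p hpD hp using hmax
  obtain ⟨R, hR⟩ := hD.isBounded.subset_closedBall 0
  have hR' : ∀ x ∈ D, ‖x‖ ≤ R := fun x hx => by simpa using hR hx
  have hR0 : 0 ≤ R := (norm_nonneg _).trans (hR' _ (hpD 0))
  have hlip : LipschitzWith (Real.toNNReal (‖u‖ * R))
      fun τ : ℝ => (inner ℝ (v + τ • u) (p τ) : ℝ) := by
    refine LipschitzWith.of_le_add_mul _ fun τ τ' => ?_
    rw [Real.coe_toNNReal _ (by positivity), Real.dist_eq]
    have h1 : inner ℝ (v + τ' • u) (p τ) ≤ inner ℝ (v + τ' • u) (p τ') := hp τ' (hpD τ)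
    have h2 : inner ℝ (v + τ • u) (p τ) =
        inner ℝ (v + τ' • u) (p τ) + (τ - τ') * inner ℝ u (p τ) := by
      simp only [inner_add_left, real_inner_smul_left]; ring
    have h3 : |inner ℝ u (p τ)| ≤ ‖u‖ * R := (abs_real_inner_le_norm _ _).trans
      (mul_le_mul_of_nonneg_left (hR' _ (hpD τ)) (norm_nonneg _))
    have h4 : (τ - τ') * inner ℝ u (p τ) ≤ ‖u‖ * R * |τ - τ'| := by
      refine (le_abs_self _).trans ?_
      rw [abs_mul, mul_comm]
      exact mul_le_mul_of_nonneg_right h3 (abs_nonneg _)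
    linarith
  filter_upwards [hlip.ae_differentiableAt_real] with τ hτ
  refine ⟨deriv (fun τ : ℝ => (inner ℝ (v + τ • u) (p τ) : ℝ)) τ, fun x hx hxmax => ?_⟩
  -- The support function dominates the affine function given by `x` and touches it at `τ`, so their
  -- derivatives agree there.
  have hloc : IsLocalMin (fun s : ℝ => (inner ℝ (v + s • u) (p s) : ℝ)
      - (inner ℝ v x + s * inner ℝ u x)) τ := ?_
  · have h := hloc.hasDerivAt_eq_zero
      (hτ.hasDerivAt.sub (((hasDerivAt_id τ).mul_const _).const_add _))
    linarith
  refine Filter.Eventually.of_forall fun s => ?_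
  have h1 : inner ℝ (v + s • u) x ≤ inner ℝ (v + s • u) (p s) := hp s hx
  have h2 : inner ℝ (v + τ • u) (p τ) ≤ inner ℝ (v + τ • u) x := hxmax (hpD τ)
  simp only [inner_add_left, real_inner_smul_left] at h1 h2 ⊢
  linarith

theorem exists_pos_add_smul_mem_of_mem_interior {D : Set E} {o : E} (ho : o ∈ interior D) (v : E) :
    ∃ η : ℝ, 0 < η ∧ o + η • v ∈ D := by
  have h : ∀ᶠ η in 𝓝 (0 : ℝ), o + η • v ∈ interior D :=
    (show Continuous fun η : ℝ => o + η • v by fun_prop).continuousAt.eventually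
      (isOpen_interior.mem_nhds (by simpa using ho))
  obtain ⟨η, hη, h0⟩ := ((h.filter_mono nhdsWithin_le_nhds).and
    (self_mem_nhdsWithin (s := Ioi (0 : ℝ)))).exists
  exact ⟨η, h0, interior_subset hη⟩

theorem exists_inner_lt_of_mem_interior {D : Set E} {o v : E} (ho : o ∈ interior D) (hv : v ≠ 0)
    {n : E} (hn : inner ℝ n v = 0) :
    ∃ x ∈ D, inner ℝ n x = inner ℝ n o ∧ inner ℝ v o < inner ℝ v x := by
  obtain ⟨η, hη, h⟩ := exists_pos_add_smul_mem_of_mem_interior ho v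
  refine ⟨_, h, ?_, ?_⟩
  · rw [inner_add_right, inner_smul_right, hn]; simp
  · rw [inner_add_right, inner_smul_right]
    have := real_inner_self_pos.2 hv
    have := mul_pos hη this
    linarith

end Inner

/-- `p` is the only point of `D` at which the functional `n` is least. -/
def IsUniqueMinOn (D : Set Plane) (n p : Plane) : Prop :=
  p ∈ D ∧ ∀ x ∈ D, inner ℝ n x ≤ inner ℝ n p → x = p

theorem IsUniqueMinOn.le {D : Set Plane} {n p : Plane} (h : IsUniqueMinOn D n p) {x : Plane}
    (hx : x ∈ D) : inner ℝ n p ≤ inner ℝ n x := by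
  by_contra! hlt
  exact hlt.ne (by rw [h.2 x hx hlt.le])

/-- For almost every `τ`, `u` is constant on the faces where `w + τ • u` is extremal; these two
functionals are independent, so each face is one point. -/
theorem exists_isUniqueMinOn_perturbation {D : Set Plane} (hD : IsCompact D) (hne : D.Nonempty)
    {w u : Plane} (hw : w ≠ 0) (hu : u ≠ 0) (hwu : inner ℝ w u = 0) {δ : ℝ} (hδ : 0 < δ) :
    ∃ τ ∈ Ioo 0 δ, ∃ p q, IsUniqueMinOn D (w + τ • u) p ∧ IsUniqueMinOn D (-(w + τ • u)) q := by
  have hae := (hD.ae_inner_eq_of_isMaxOn hne w u).and (hD.ae_inner_eq_of_isMaxOn hne (-w) (-u))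
  obtain ⟨τ, ⟨⟨m, hm⟩, ⟨m', hm'⟩⟩, hτ⟩ : ∃ τ, ((∃ m : ℝ, ∀ x ∈ D,
      IsMaxOn (fun y => inner ℝ (w + τ • u) y) D x → inner ℝ u x = m) ∧ (∃ m : ℝ, ∀ x ∈ D,
      IsMaxOn (fun y => inner ℝ (-w + τ • -u) y) D x → inner ℝ (-u) x = m)) ∧ τ ∈ Ioo 0 δ := by
    have hfreq : ∃ᶠ τ in MeasureTheory.ae MeasureTheory.volume, τ ∈ Ioo 0 δ := by
      rw [MeasureTheory.frequently_ae_mem_iff, Real.volume_Ioo]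
      simpa using hδ
    exact (hfreq.and_eventually hae).exists.imp fun τ h => ⟨h.2, h.1⟩
  have huniq : ∀ x y : Plane, inner ℝ (w + τ • u) x = inner ℝ (w + τ • u) y →
      inner ℝ u x = inner ℝ u y → x = y := by
    intro x y h1 h2
    refine sub_eq_zero.1 (Plane.eq_zero_of_inner_eq_zero hw hu hwu ?_ ?_)
    · simp only [inner_add_left, real_inner_smul_left] at h1
      rw [inner_sub_right]; rw [h2] at h1; linarith
    · rw [inner_sub_right, h2, sub_self]
  have hneg : -w + τ • -u = -(w + τ • u) := by module
  rw [hneg] at hm'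
  obtain ⟨p, hpD, hp⟩ := hD.exists_isMinOn hne (f := fun x => inner ℝ (w + τ • u) x) (by fun_prop)
  obtain ⟨q, hqD, hq⟩ := hD.exists_isMaxOn hne (f := fun x => inner ℝ (w + τ • u) x) (by fun_prop)
  have hmin : ∀ x ∈ D, inner ℝ (w + τ • u) x ≤ inner ℝ (w + τ • u) p →
      IsMaxOn (fun y => inner ℝ (-(w + τ • u)) y) D x := by
    intro x hx h y hy
    have : inner ℝ (w + τ • u) p ≤ inner ℝ (w + τ • u) y := hp hy
    simp only [inner_neg_left, mem_ofPred_eq]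
    linarith
  have hmax : ∀ x ∈ D, inner ℝ (w + τ • u) q ≤ inner ℝ (w + τ • u) x →
      IsMaxOn (fun y => inner ℝ (w + τ • u) y) D x := by
    intro x hx h y hy
    have : inner ℝ (w + τ • u) y ≤ inner ℝ (w + τ • u) q := hq hy
    exact this.trans h
  refine ⟨τ, hτ, p, q, ⟨hpD, fun x hx h => ?_⟩, ⟨hqD, fun x hx h => ?_⟩⟩
  · refine huniq x p (le_antisymm h (hp hx)) ?_
    have h1 := (hm' x hx (hmin x hx h)).trans (hm' p hpD (hmin p hpD le_rfl)).symm
    simpa [inner_neg_left] using h1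
  · simp only [inner_neg_left, neg_le_neg_iff] at h
    refine huniq x q (le_antisymm (hq hx) h) ?_
    exact (hm x hx (hmax x hx h)).trans (hm q hqD (hmax q hqD le_rfl)).symm

/-! ### Sweeping by parallel chords. -/

theorem MapClusterPt.eq_of_tendsto {X Y : Type*} [TopologicalSpace X] [T2Space X] {l : Filter Y}
    {f : Y → X} {x y : X} (h : MapClusterPt x l f) (hf : Tendsto f l (𝓝 y)) : x = y := by
  have : ClusterPt x (𝓝 y) := ClusterPt.mono h hf
  exact @eq_of_nhds_neBot _ _ _ _ _ this

/-- The part of the boundary of a convex body that lies in direction `e` is a continuous curve. -/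
theorem Convex.exists_continuousOn_upper {D : Set Plane} (hconv : Convex ℝ D) (hD : IsCompact D)
    {n e p q : Plane} (hn : n ≠ 0) (he : e ≠ 0) (hne : inner ℝ n e = 0)
    (hp : IsUniqueMinOn D n p) (hq : IsUniqueMinOn D (-n) q) :
    ∃ P : ℝ → Plane, ContinuousOn P (Icc (inner ℝ n p) (inner ℝ n q)) ∧
      ∀ c ∈ Icc (inner ℝ n p : ℝ) (inner ℝ n q), P c ∈ D ∧ inner ℝ n (P c) = c ∧
        ∀ x ∈ D, inner ℝ n x = c → inner ℝ e x ≤ inner ℝ e (P c) := by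
  set α : ℝ := inner ℝ n p
  set β : ℝ := inner ℝ n q
  have hex : ∀ c, ∃ x, c ∈ Icc α β → x ∈ D ∧ inner ℝ n x = c ∧
      ∀ y ∈ D, inner ℝ n y = c → inner ℝ e y ≤ inner ℝ e x := by
    intro c
    by_cases hc : c ∈ Icc α β
    · obtain ⟨y, hy, hyc⟩ := hconv.isPreconnected.intermediate_value hp.1 hq.1
        (f := fun x => inner ℝ n x) (by fun_prop) hc
      have hcpt : IsCompact (D ∩ {x | inner ℝ n x = c}) :=
        hD.inter_right (isClosed_eq (by fun_prop) continuous_const)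
      obtain ⟨x, hx, hmax⟩ := hcpt.exists_isMaxOn ⟨y, hy, hyc⟩ (f := fun x => inner ℝ e x)
        (by fun_prop)
      exact ⟨x, fun _ => ⟨hx.1, hx.2, fun z hz hzc => hmax ⟨hz, hzc⟩⟩⟩
    · exact ⟨0, fun h => absurd h hc⟩
  choose P hP using hex
  refine ⟨P, ?_, hP⟩
  -- Concavity gives continuity only in the open interval; at its ends the slices are single points
  -- and compactness takes over.
  have hconc : ConcaveOn ℝ (Icc α β) fun c => (inner ℝ e (P c) : ℝ) := by
    refine ⟨convex_Icc _ _, fun c hc d hd μ ν hμ hν hμν => ?_⟩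
    obtain ⟨h1, h2, -⟩ := hP c hc
    obtain ⟨h3, h4, -⟩ := hP d hd
    have := (hP _ (convex_Icc α β hc hd hμ hν hμν)).2.2 _ (hconv h1 h3 hμ hν hμν)
      (by rw [inner_add_right, inner_smul_right, inner_smul_right, h2, h4]; rfl)
    rwa [inner_add_right, inner_smul_right, inner_smul_right] at this
  have hn' : (inner ℝ n n : ℝ) ≠ 0 := inner_self_ne_zero.2 hn
  have he' : (inner ℝ e e : ℝ) ≠ 0 := inner_self_ne_zero.2 he
  have hen : (inner ℝ e n : ℝ) = 0 := by rw [real_inner_comm, hne]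
  have hrep : ∀ c ∈ Icc α β, P c =
      (c / inner ℝ n n : ℝ) • n + (inner ℝ e (P c) / inner ℝ e e : ℝ) • e := by
    intro c hc
    refine sub_eq_zero.1 (Plane.eq_zero_of_inner_eq_zero hn he hne ?_ ?_)
    · rw [inner_sub_right, inner_add_right, inner_smul_right, inner_smul_right, hne, (hP c hc).2.1,
        div_mul_cancel₀ _ hn']
      ring
    · rw [inner_sub_right, inner_add_right, inner_smul_right, inner_smul_right, hen,
        div_mul_cancel₀ _ he']
      ring
  have hface : ∀ c ∈ Icc α β, (∀ x ∈ D, inner ℝ n x = c → x = P c) →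
      ContinuousWithinAt P (Icc α β) c := by
    intro c hc hu
    refine hD.tendsto_nhds_of_unique_mapClusterPt
      (eventually_mem_nhdsWithin.mono fun d hd => (hP d hd).1) fun x hx hcl => hu x hx ?_
    refine MapClusterPt.eq_of_tendsto (l := 𝓝[Icc α β] c) (f := fun d => inner ℝ n (P d))
      (hcl.tendsto_comp (show Continuous fun y : Plane => (inner ℝ n y : ℝ)
        by fun_prop).continuousAt) ?_
    refine (tendsto_id.mono_left nhdsWithin_le_nhds).congr' ?_
    filter_upwards [self_mem_nhdsWithin] with d hd using (hP d hd).2.1.symm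
  intro c hc
  rcases hc.1.eq_or_lt with h1 | h1
  · have hpu : ∀ x ∈ D, inner ℝ n x = c → x = p := fun x hx hxc => hp.2 x hx (by rw [hxc, ← h1])
    refine hface c hc fun x hx hxc => ?_
    rw [hpu x hx hxc, hpu _ (hP c hc).1 (hP c hc).2.1]
  rcases hc.2.eq_or_lt with h2 | h2
  · have hqu : ∀ x ∈ D, inner ℝ n x = c → x = q := fun x hx hxc =>
      hq.2 x hx (by rw [inner_neg_left, inner_neg_left, hxc, h2])
    refine hface c hc fun x hx hxc => ?_
    rw [hqu x hx hxc, hqu _ (hP c hc).1 (hP c hc).2.1]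
  · have hcont : ContinuousWithinAt (fun c => (inner ℝ e (P c) : ℝ)) (Icc α β) c := by
      refine ContinuousAt.continuousWithinAt (hconc.continuousOn_interior.continuousAt ?_)
      rw [interior_Icc]
      exact Ioo_mem_nhds h1 h2
    refine ContinuousWithinAt.congr (f := fun c =>
      (c / inner ℝ n n : ℝ) • n + (inner ℝ e (P c) / inner ℝ e e : ℝ) • e) ?_ hrep (hrep c hc)
    exact ((continuousWithinAt_id.div_const _).smul continuousWithinAt_const).add
      ((hcont.div_const _).smul continuousWithinAt_const)

theorem Plane.exists_eq_add_smul_sub {n e P Q x : Plane} (hn : n ≠ 0) (he : e ≠ 0)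
    (hne : inner ℝ n e = 0) (hP : inner ℝ n P = inner ℝ n x) (hQ : inner ℝ n Q = inner ℝ n x)
    (h1 : inner ℝ e Q ≤ inner ℝ e x) (h2 : inner ℝ e x ≤ inner ℝ e P) :
    ∃ τ : I, x = Q + (τ : ℝ) • (P - Q) := by
  set r : ℝ := (inner ℝ e x - inner ℝ e Q) / (inner ℝ e P - inner ℝ e Q)
  -- If `P` and `Q` have equal height, then `r = 0` by convention and `x` has that height too.
  have hr : r * (inner ℝ e P - inner ℝ e Q) = inner ℝ e x - inner ℝ e Q :=
    div_mul_cancel_of_imp fun h => by linarith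
  refine ⟨⟨r, div_nonneg (by linarith) (by linarith), div_le_one_of_le₀ (by linarith)
    (by linarith)⟩, ?_⟩
  refine sub_eq_zero.1 (Plane.eq_zero_of_inner_eq_zero hn he hne ?_ ?_)
  · simp only [inner_sub_right, inner_add_right, inner_smul_right, hP, hQ]
    ring
  · simp only [inner_sub_right, inner_add_right, inner_smul_right]
    linarith

theorem curveLength_segment_le (Q v : Plane) :
    curveLength (fun s : I => Q + (s : ℝ) • v) ≤ ENNReal.ofReal ‖v‖ := by
  have hlip : LipschitzOnWith ‖v‖₊ (fun s : ℝ => Q + s • v) univ := by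
    refine LipschitzWith.lipschitzOnWith (LipschitzWith.of_dist_le_mul fun s t => ?_)
    rw [dist_add_left, dist_eq_norm, ← sub_smul, norm_smul, Real.dist_eq, coe_nnnorm,
      Real.norm_eq_abs, mul_comm]
  have hmono : eVariationOn (fun s : I => (s : ℝ)) univ ≤ 1 := by
    have h : univ ∩ Icc (0 : I) 1 = univ :=
      eq_univ_of_forall fun s => ⟨mem_univ _, unitInterval.nonneg', unitInterval.le_one'⟩
    have := ((Subtype.mono_coe (· ∈ I)).monotoneOn univ).eVariationOn_eq
      (mem_univ (0 : I)) (mem_univ (1 : I))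
    rw [h] at this
    simpa using this.le
  refine (hlip.comp_eVariationOn_le (g := fun s : I => (s : ℝ)) (mapsTo_univ _ _)).trans ?_
  calc (‖v‖₊ : ℝ≥0∞) * eVariationOn (fun s : I => (s : ℝ)) univ ≤ ‖v‖₊ * 1 := by gcongr
    _ = ENNReal.ofReal ‖v‖ := by rw [mul_one, ofReal_norm, enorm_eq_nnnorm]

/-- A convex body is swept by its chords parallel to `e`, provided that the two extreme chords are
single points. -/
theorem Convex.exists_isSweep {D : Set Plane} (hconv : Convex ℝ D) (hD : IsCompact D)
    (hint : (interior D).Nonempty)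
    {n e p q : Plane} (hn : n ≠ 0) (he : e ≠ 0) (hne : inner ℝ n e = 0)
    (hp : IsUniqueMinOn D n p) (hq : IsUniqueMinOn D (-n) q) :
    ∃ f, IsSweep D f ∧ ∀ t, ∃ x ∈ D, ∃ y ∈ D, inner ℝ n x = inner ℝ n y ∧
      curveLength (fun s => f s t) ≤ ENNReal.ofReal ‖y - x‖ := by
  have hen : inner ℝ e n = 0 := by rw [real_inner_comm, hne]
  obtain ⟨P, hPc, hP⟩ := hconv.exists_continuousOn_upper hD hn he hne hp hq
  -- The lower boundary is the upper one for `-e`.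
  obtain ⟨Q, hQc, hQ⟩ := hconv.exists_continuousOn_upper hD hn (neg_ne_zero.2 he)
    (by rw [inner_neg_right, hne, neg_zero]) hp hq
  simp only [inner_neg_left, neg_le_neg_iff] at hQ
  have hple : ∀ x ∈ D, inner ℝ n p ≤ inner ℝ n x := fun x hx => hp.le hx
  have hqle : ∀ x ∈ D, inner ℝ n x ≤ inner ℝ n q := fun x hx => by
    simpa [inner_neg_left] using hq.le hx
  have hpu : ∀ x ∈ D, inner ℝ n x = inner ℝ n p → x = p := fun x hx h => hp.2 x hx h.le
  have hqu : ∀ x ∈ D, inner ℝ n x = inner ℝ n q → x = q := fun x hx h =>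
    hq.2 x hx (by rw [inner_neg_left, inner_neg_left, h])
  set α : ℝ := inner ℝ n p
  set β : ℝ := inner ℝ n q
  have hleft : ∀ o ∈ interior D, α < inner ℝ n o := fun o ho => by
    obtain ⟨x, hx, -, hlt⟩ := exists_inner_lt_of_mem_interior ho (neg_ne_zero.2 hn)
      (n := e) (by rw [inner_neg_right, hen, neg_zero])
    simp only [inner_neg_left] at hlt
    linarith [hple x hx]
  have hright : ∀ o ∈ interior D, inner ℝ n o < β := fun o ho => by
    obtain ⟨x, hx, -, hlt⟩ := exists_inner_lt_of_mem_interior ho hn hen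
    linarith [hqle x hx]
  have hup : ∀ o ∈ interior D, inner ℝ e o < inner ℝ e (P (inner ℝ n o)) := fun o ho => by
    obtain ⟨x, hx, h, hlt⟩ := exists_inner_lt_of_mem_interior ho he hne
    exact hlt.trans_le ((hP _ ⟨hple _ (interior_subset ho), hqle _ (interior_subset ho)⟩).2.2 x hx h)
  have hdown : ∀ o ∈ interior D, inner ℝ e (Q (inner ℝ n o)) < inner ℝ e o := fun o ho => by
    obtain ⟨x, hx, h, hlt⟩ := exists_inner_lt_of_mem_interior ho (neg_ne_zero.2 he)
      (n := n) (by rw [inner_neg_right, hne, neg_zero])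
    simp only [inner_neg_left, neg_lt_neg_iff] at hlt
    exact ((hQ _ ⟨hple _ (interior_subset ho), hqle _ (interior_subset ho)⟩).2.2 x hx h).trans_lt
      hlt
  have hslice : ∀ c ∈ Ioo α β, ∃ o ∈ interior D, inner ℝ n o = c := by
    intro c hc
    have hcl : D ⊆ closure (interior D) := by
      rw [hconv.closure_interior_eq_closure_of_nonempty_interior hint]
      exact subset_closure
    obtain ⟨x, hxc, hx⟩ := mem_closure_iff.1 (hcl hp.1) {x | inner ℝ n x < c}
      (isOpen_lt (by fun_prop) continuous_const) hc.1
    obtain ⟨y, hyc, hy⟩ := mem_closure_iff.1 (hcl hq.1) {x | c < inner ℝ n x}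
      (isOpen_lt continuous_const (by fun_prop)) hc.2
    exact hconv.interior.isPreconnected.intermediate_value hx hy (f := fun x => inner ℝ n x)
      (by fun_prop) ⟨(show inner ℝ n x < c from hxc).le, (show c < inner ℝ n y from hyc).le⟩
  have hαβ : α < β := by
    obtain ⟨o, ho⟩ := hint
    exact (hleft o ho).trans (hright o ho)
  let c : I → ℝ := fun t => α + t * (β - α)
  have hc : Continuous c := by fun_prop
  have hcI : ∀ t, c t ∈ Icc α β := fun t =>
    ⟨by nlinarith [t.2.1], by nlinarith [t.2.2]⟩
  have hc0 : c 0 = α := by simp [c]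
  have hc1 : c 1 = β := by simp [c]
  have hPD : ∀ t, P (c t) ∈ D := fun t => (hP _ (hcI t)).1
  have hQD : ∀ t, Q (c t) ∈ D := fun t => (hQ _ (hcI t)).1
  have hPn : ∀ t, inner ℝ n (P (c t)) = c t := fun t => (hP _ (hcI t)).2.1
  have hQn : ∀ t, inner ℝ n (Q (c t)) = c t := fun t => (hQ _ (hcI t)).2.1
  have hPcont : Continuous fun t => P (c t) := hPc.comp_continuous hc hcI
  have hQcont : Continuous fun t => Q (c t) := hQc.comp_continuous hc hcI
  let f : I → I → Plane := fun s t => Q (c t) + (s : ℝ) • (P (c t) - Q (c t))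
  have hf0 : ∀ t, f 0 t = Q (c t) := fun t => by simp [f]
  have hf1 : ∀ t, f 1 t = P (c t) := fun t => by simp [f]
  have hfD : ∀ s t, f s t ∈ D := fun s t => hconv.add_smul_sub_mem (hQD t) (hPD t) s.2
  have hfn : ∀ s t, inner ℝ n (f s t) = c t := fun s t => by
    simp only [f, inner_add_right, inner_smul_right, inner_sub_right, hPn, hQn]; ring
  have hfcont : Continuous fun z : I × I => f z.1 z.2 :=
    (hQcont.comp continuous_snd).add ((continuous_subtype_val.comp continuous_fst).smul
      ((hPcont.comp continuous_snd).sub (hQcont.comp continuous_snd)))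
  have hfmid : ∀ t : I, 0 < t → t < 1 → ∃ τ : I, 0 < τ ∧ τ < 1 ∧ f τ t ∈ interior D := by
    intro t h0 h1
    have h0' : (0 : ℝ) < t := h0
    have h1' : (t : ℝ) < 1 := h1
    obtain ⟨o, ho, hoc⟩ := hslice (c t) ⟨by nlinarith, by nlinarith⟩
    have h2 := hdown o ho
    have h3 := hup o ho
    rw [hoc] at h2 h3
    obtain ⟨τ, hτ⟩ := Plane.exists_eq_add_smul_sub hn he hne ((hPn t).trans hoc.symm)
      ((hQn t).trans hoc.symm) h2.le h3.le
    have hτ' : o = f τ t := hτ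
    refine ⟨τ, unitInterval.pos_iff_ne_zero.2 ?_, unitInterval.lt_one_iff_ne_one.2 ?_, hτ' ▸ ho⟩
    · rintro rfl; rw [hτ', hf0] at h2; exact h2.false
    · rintro rfl; rw [hτ', hf1] at h3; exact h3.false
  have hlen : ∀ t, curveLength (fun s => f s t) ≤ ENNReal.ofReal ‖P (c t) - Q (c t)‖ :=
    fun t => curveLength_segment_le _ _
  have hPQ0 : ∀ s, f s 0 = p := fun s => hpu _ (hfD s 0) (by rw [hfn, hc0])
  have hPQ1 : ∀ s, f s 1 = q := fun s => hqu _ (hfD s 1) (by rw [hfn, hc1])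
  have hfront : ∀ s t, f s t ∈ frontier D ↔ (s = 0 ∨ s = 1) ∨ (t = 0 ∨ t = 1) := by
    intro s t
    rw [hD.isClosed.frontier_eq]
    constructor
    · rintro ⟨-, hni⟩
      by_contra! hst
      obtain ⟨⟨hs0, hs1⟩, ht0, ht1⟩ := hst
      have hs0' : (0 : ℝ) < s := unitInterval.pos_iff_ne_zero.2 hs0
      have hs1' : (s : ℝ) < 1 := unitInterval.lt_one_iff_ne_one.2 hs1
      obtain ⟨τ, h0, h1, hτ⟩ := hfmid t (unitInterval.pos_iff_ne_zero.2 ht0)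
        (unitInterval.lt_one_iff_ne_one.2 ht1)
      have h0' : (0 : ℝ) < τ := h0
      have h1' : (τ : ℝ) < 1 := h1
      refine hni ?_
      -- A point strictly between an end of the chord and an interior point is interior.
      rcases le_total (s : ℝ) τ with h | h
      · convert hconv.combo_interior_self_mem_interior hτ (hQD t) (a := (s / τ : ℝ))
          (b := 1 - s / τ) (by positivity) (sub_nonneg.2 ((div_le_one h0').2 h)) (by ring) using 1
        have : (s : ℝ) = s / τ * τ := by field_simp
        simp only [f]
        rw [smul_add, smul_smul, ← this]
        module
      · have h1'' : (0 : ℝ) < 1 - τ := by linarith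
        convert hconv.combo_interior_self_mem_interior hτ (hPD t) (a := ((1 - s) / (1 - τ) : ℝ))
          (b := 1 - (1 - s) / (1 - τ)) (div_pos (by linarith) h1'')
          (sub_nonneg.2 ((div_le_one h1'').2 (by linarith))) (by ring) using 1
        have : (s : ℝ) = 1 - (1 - s) / (1 - τ) * (1 - τ) := by field_simp; ring
        simp only [f]
        generalize ((1 - s) / (1 - τ) : ℝ) = k at this ⊢
        rw [this]
        module
    · intro h
      refine ⟨hfD s t, fun hi => ?_⟩
      rcases h with (rfl | rfl) | (rfl | rfl)
      · have := hdown _ hi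
        rw [hfn, hf0] at this
        exact this.false
      · have := hup _ hi
        rw [hfn, hf1] at this
        exact this.false
      · have := hleft _ hi
        rw [hfn, hc0] at this
        exact this.false
      · have := hright _ hi
        rw [hfn, hc1] at this
        exact this.false
  refine ⟨f, ⟨⟨hfcont, hfD, fun t _ _ => ((hlen t).trans_lt ENNReal.ofReal_lt_top).ne, ?_,
    ⟨p, ?_, hPQ0⟩, ⟨q, ?_, hPQ1⟩, hfront⟩, ?_⟩,
    fun t => ⟨Q (c t), hQD t, P (c t), hPD t, by rw [hPn, hQn], hlen t⟩⟩
  · intro t h0 h1 s s' hss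
    obtain ⟨τ, hτ0, -, hτ⟩ := hfmid t h0 h1
    have hne0 : P (c t) - Q (c t) ≠ 0 := by
      intro h
      have h2 := (hfront 0 t).2 (by simp)
      rw [hD.isClosed.frontier_eq] at h2
      refine h2.2 ?_
      simpa [f, h] using hτ
    exact Subtype.ext (smul_left_injective ℝ hne0 (add_left_cancel hss))
  · rw [← hPQ0 0]; exact (hfront 0 0).2 (by simp)
  · rw [← hPQ1 0]; exact (hfront 0 1).2 (by simp)
  · intro γ hγ hγD
    -- By the intermediate value theorem the moving line through the chord meets the intruder.
    obtain ⟨t, ht⟩ : ∃ t, c t - inner ℝ n (γ t) = 0 :=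
      mem_range_of_exists_le_of_exists_ge (by fun_prop)
        ⟨0, by rw [hc0]; linarith [hple _ (hγD 0)]⟩ ⟨1, by rw [hc1]; linarith [hqle _ (hγD 1)]⟩
    have ht' : inner ℝ n (γ t) = c t := by linarith
    obtain ⟨τ, hτ⟩ := Plane.exists_eq_add_smul_sub hn he hne ((hPn t).trans ht'.symm)
      ((hQn t).trans ht'.symm) ((hQ _ (hcI t)).2.2 _ (hγD t) ht')
      ((hP _ (hcI t)).2.2 _ (hγD t) ht')
    exact ⟨t, τ, hτ.symm⟩

/-! ### Upper bound for the cost, both bounds for the width, and the conclusion. -/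

theorem sweepingCost_le {D : Set Plane} (hconv : Convex ℝ D) (hD : IsCompact D)
    (hint : (interior D).Nonempty) {u : Plane} (hu : ‖u‖ = 1) {a b : ℝ}
    (ha : IsLeast ((fun x : Plane => inner ℝ u x) '' D) a)
    (hb : IsGreatest ((fun x : Plane => inner ℝ u x) '' D) b) :
    sweepingCost D ≤ ENNReal.ofReal (b - a) := by
  have hu0 : u ≠ 0 := by rintro rfl; simp at hu
  set w := Plane.rot u
  have hw0 : w ≠ 0 := Plane.rot_ne_zero hu0
  have hwu : inner ℝ w u = 0 := Plane.inner_rot_self u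
  have huw : inner ℝ u w = 0 := by rw [real_inner_comm, hwu]
  have huu : inner ℝ u u = (1 : ℝ) := by rw [real_inner_self_eq_norm_sq, hu, one_pow]
  have hww : inner ℝ w w = (1 : ℝ) := by rw [Plane.inner_rot_rot, huu]
  have hw1 : ‖w‖ = 1 := by
    rw [real_inner_self_eq_norm_sq] at hww
    nlinarith [norm_nonneg w]
  have hextent : ∀ x ∈ D, ∀ y ∈ D, inner ℝ u y - inner ℝ u x ≤ b - a := fun x hx y hy =>
    sub_le_sub (hb.2 (mem_image_of_mem _ hy)) (ha.2 (mem_image_of_mem _ hx))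
  have hab : 0 ≤ b - a := by
    obtain ⟨o, ho⟩ := hint
    simpa using hextent o (interior_subset ho) o (interior_subset ho)
  have key : ∀ δ : ℝ, 0 < δ → sweepingCost D ≤ ENNReal.ofReal ((b - a) * (1 + δ)) := by
    intro δ hδ
    obtain ⟨τ, ⟨hτ0, hτδ⟩, p, q, hp, hq⟩ := exists_isUniqueMinOn_perturbation hD
      (hint.mono interior_subset) hw0 hu0 hwu hδ
    have hn : w + τ • u ≠ 0 := by
      intro h
      have := congrArg (fun x : Plane => (inner ℝ w x : ℝ)) h
      simp [inner_add_right, inner_smul_right, hwu, hw1] at this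
    have he : u - τ • w ≠ 0 := by
      intro h
      have := congrArg (fun x : Plane => (inner ℝ u x : ℝ)) h
      simp [inner_sub_right, inner_smul_right, huw, hu] at this
    obtain ⟨f, hf, hlen⟩ := hconv.exists_isSweep hD hint hn he
      (by simp only [inner_sub_right, inner_add_left, inner_smul_right, real_inner_smul_left,
            hwu, huw, huu, hww]
          ring) hp hq
    refine (iInf₂_le f hf).trans (iSup_le fun t => ?_)
    obtain ⟨x, hx, y, hy, hxy, hle⟩ := hlen t
    refine hle.trans (ENNReal.ofReal_le_ofReal ?_)
    -- The chord is orthogonal to `w + τ • u`, hence parallel to `u - τ • w`, whose `u`-component is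
    -- `1`.
    have hrep : y - x = inner ℝ u (y - x) • (u - τ • w) := by
      refine sub_eq_zero.1 (Plane.eq_zero_of_inner_eq_zero hu0 hw0 huw ?_ ?_)
      · simp only [inner_sub_right, inner_smul_right, huu, huw]; ring
      · simp only [inner_add_left, real_inner_smul_left] at hxy
        simp only [inner_sub_right, inner_smul_right, hww, hwu]
        linear_combination -hxy
    have habs : |inner ℝ u (y - x)| ≤ b - a := by
      rw [inner_sub_right, abs_le]
      exact ⟨by linarith [hextent y hy x hx], hextent x hx y hy⟩
    rw [hrep, norm_smul, Real.norm_eq_abs]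
    refine mul_le_mul habs ?_ (norm_nonneg _) hab
    calc ‖u - τ • w‖ ≤ ‖u‖ + ‖τ • w‖ := norm_sub_le _ _
      _ = 1 + τ := by rw [norm_smul, hu, hw1, mul_one, Real.norm_of_nonneg hτ0.le]
      _ ≤ 1 + δ := by linarith
  have hlim : Tendsto (fun δ : ℝ => ENNReal.ofReal ((b - a) * (1 + δ))) (𝓝[>] 0)
      (𝓝 (ENNReal.ofReal (b - a))) := by
    refine Tendsto.mono_left ?_ nhdsWithin_le_nhds
    have : Continuous fun δ : ℝ => ENNReal.ofReal ((b - a) * (1 + δ)) :=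
      ENNReal.continuous_ofReal.comp (by fun_prop)
    simpa using this.tendsto 0
  exact ge_of_tendsto hlim (eventually_mem_nhdsWithin.mono fun δ hδ => key δ hδ)

theorem width_le {D : Set Plane} {u : Plane} (hu : ‖u‖ = 1) {a b : ℝ}
    (ha : IsLeast ((fun x : Plane => inner ℝ u x) '' D) a)
    (hb : IsGreatest ((fun x : Plane => inner ℝ u x) '' D) b) :
    width D ≤ ENNReal.ofReal (b - a) := by
  refine (iInf₂_le u hu).trans (iSup_le fun x => ?_)
  have hsub : {t : ℝ | x + t • u ∈ D} ⊆ Icc (a - inner ℝ u x) (b - inner ℝ u x) := by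
    intro t ht
    have h1 := ha.2 (mem_image_of_mem _ ht)
    have h2 := hb.2 (mem_image_of_mem _ ht)
    simp only [inner_add_right, inner_smul_right, real_inner_self_eq_norm_sq, hu] at h1 h2
    exact ⟨by linarith, by linarith⟩
  refine (MeasureTheory.measure_mono hsub).trans ?_
  rw [Real.volume_Icc, sub_sub_sub_cancel_right]

/-- For every `r' < W`, `D` contains a segment from some `z` to `z + r' • v`. -/
theorem Convex.le_width {D : Set Plane} (hconv : Convex ℝ D) (hD : IsCompact D)
    (hint : (interior D).Nonempty) {W : ℝ}
    (hW : ∀ (u : Plane) (a b : ℝ), ‖u‖ = 1 → IsLeast ((fun x : Plane => inner ℝ u x) '' D) a →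
        IsGreatest ((fun x : Plane => inner ℝ u x) '' D) b → W ≤ b - a) :
    ENNReal.ofReal W ≤ width D := by
  refine le_iInf₂ fun v hv => le_of_forall_lt fun r hr => ?_
  obtain ⟨r', hrr', hr'⟩ := exists_between hr
  lift r' to NNReal using (hr'.trans ENNReal.ofReal_lt_top).ne
  have hr'' : (r' : ℝ) < W := by
    rw [← ENNReal.ofReal_coe_nnreal] at hr'
    exact (ENNReal.ofReal_lt_ofReal_iff'.1 hr').1
  obtain ⟨z, hz, hz'⟩ := hconv.exists_translate_mem_interior hD hint hW
    (d := (r' : ℝ) • v) (by rw [norm_smul, hv, mul_one, Real.norm_of_nonneg r'.coe_nonneg]; exact hr'')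
  refine hrr'.trans_le (le_trans ?_ (le_iSup _ z))
  have hsub : Icc (0 : ℝ) r' ⊆ {t : ℝ | z + t • v ∈ D} := by
    have hline : Convex ℝ {t : ℝ | z + t • v ∈ D} := by
      intro s hs t ht μ ν hμ hν hμν
      have := hconv hs ht hμ hν hμν
      have e : z + (μ • s + ν • t) • v = μ • (z + s • v) + ν • (z + t • v) := by
        rw [show z + (μ • s + ν • t) • v = (μ + ν) • z + (μ • s + ν • t) • v by
          rw [hμν, one_smul]]
        module
      rwa [← e] at this
    exact hline.ordConnected.out (show z + (0 : ℝ) • v ∈ D by simpa using interior_subset hz)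
      (show z + (r' : ℝ) • v ∈ D from interior_subset hz')
  refine le_trans ?_ (MeasureTheory.measure_mono hsub)
  rw [Real.volume_Icc, sub_zero, ENNReal.ofReal_coe_nnreal]

theorem mainTheorem2 (D : Set Plane) (hD : IsJordanDomain D) (hconv : Convex ℝ D) :
    sweepingCost D = width D ∧
      IsLeast (supportingLineDistances D) (sweepingCost D) := by
  have hcpt := hD.isCompact
  have hint := hD.interior_nonempty hconv
  obtain ⟨u, a, b, hu, ha, hb, hmin⟩ := hcpt.exists_isLeast_extent hD.nonempty
  have hcost : sweepingCost D = ENNReal.ofReal (b - a) :=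
    le_antisymm (sweepingCost_le hconv hcpt hint hu ha hb)
      (le_iInf₂ fun f hf => hf.le_sensorLength hconv hcpt hint hmin)
  have hwidth : width D = ENNReal.ofReal (b - a) :=
    le_antisymm (width_le hu ha hb) (hconv.le_width hcpt hint hmin)
  refine ⟨hcost.trans hwidth.symm, ?_⟩
  rw [hcost]
  refine ⟨⟨u, a, b, hu, ha, hb, rfl⟩, ?_⟩
  rintro _ ⟨u', a', b', hu', ha', hb', rfl⟩
  exact ENNReal.ofReal_le_ofReal (hmin u' a' b' hu' ha' hb')
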